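/- A finite binary word is an element of $\{0,1\}^*$; $\varepsilon$ is the empty word. Let $R$ be the reversal map on $\{0,1\}^*$, and let $E$ be the exchange antimorphism, which reverses a word and exchanges the letters $0$ and $1$. For $\vartheta\in\{E,R\}$, a word $w$ is a $\vartheta$-palindrome if $\vartheta(w)=w$, and $w^{\vartheta}$ denotes the shortest $\vartheta$-palindrome having $w$ as a prefix. For sequences $\Delta=\delta_1\delta_2\ldots$ with $\delta_i\in\{0,1\}$ and $\Theta=\vartheta_1\vartheta_2\ldots$ with $\vartheta_i\in\{E,R\}$, the binary generalized pseudostandard word $\mathbf u(\Delta,\Theta)$ is the infinite word having as prefixes all the words $w_n$ given by $w_0=\varepsilon$ and $w_{n+1}=(w_n\delta_{n+1})^{\vartheta_{n+1}}$. For an infinite word $\mathbf u$, let $\mathcal C_{\mathbf u}(n)$ be the number of factors (blocks of consecutive letters) of $\mathbf u$ of length $n$. Write $v^\omega=vvv\ldots$ for the infinite repetition of $v$. **Theorem.** The infinite word $\mathbf u_p=\mathbf u(1^\omega,(EERR)^\omega)$ satisfies $$\mathcal C_{\mathbf u_p}(n)>4n\qquad\text{for all integers } n\ge 10.$$ Consequently,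 it is false that for every binary generalized pseudostandard word $\mathbf u$ there exists $n_0\in\mathbb N$ such that $\mathcal C_{\mathbf u}(n)\le 4n$ for all $n>n_0$ (Conjecture 43 of Blondin Massé et al.). -/

import Mathlib

/-! Words over the alphabet `{0,1}` are lists of Booleans, with `false` for the letter `0` and
`true` for the letter `1`; infinite words are functions on `ℕ`. -/

namespace GenPseudostandard

/-- The two involutory antimorphisms of `{0,1}*`: the exchange antimorphism `E` and the
reversal map `R`. -/
inductive Antimorphism : Type
  | E : Antimorphism
  | R : Antimorphism

/-- The action on finite words: `R` reverses the word, `E` reverses it and exchanges the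
letters `0` and `1`. -/
def Antimorphism.apply : Antimorphism → List Bool → List Bool
  | .E, w => (w.map (fun a => !a)).reverse
  | .R, w => w.reverse

theorem Antimorphism.apply_append (θ : Antimorphism) (v w : List Bool) :
    θ.apply (v ++ w) = θ.apply w ++ θ.apply v := by
  cases θ <;> simp [Antimorphism.apply]

theorem Antimorphism.apply_apply (θ : Antimorphism) (w : List Bool) :
    θ.apply (θ.apply w) = w := by
  cases θ <;> simp [Antimorphism.apply, Function.comp_def]

theorem Antimorphism.length_apply (θ : Antimorphism) (w : List Bool) :
    (θ.apply w).length = w.length := by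
  cases θ <;> simp [Antimorphism.apply]

/-- `w` is a `θ`-palindrome: `θ(w) = w`. -/
def IsPalindrome (θ : Antimorphism) (w : List Bool) : Prop :=
  θ.apply w = w

/-- `v` is a shortest `θ`-palindrome having `w` as a prefix. -/
def IsClosure (θ : Antimorphism) (w v : List Bool) : Prop :=
  IsPalindrome θ v ∧ w <+: v ∧
    ∀ v' : List Bool, IsPalindrome θ v' → w <+: v' → v.length ≤ v'.length

theorem isPalindrome_append_apply (θ : Antimorphism) (w : List Bool) :
    IsPalindrome θ (w ++ θ.apply w) := by
  simp [IsPalindrome, Antimorphism.apply_append, Antimorphism.apply_apply]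

theorem IsClosure.eq {θ : Antimorphism} {w v v' : List Bool}
    (h : IsClosure θ w v) (h' : IsClosure θ w v') : v = v' := by
  have key : ∀ t : List Bool, IsClosure θ w (w ++ t) → t <:+ θ.apply w := by
    intro t ht
    have hlen := ht.2.2 _ (isPalindrome_append_apply θ w) (List.prefix_append _ _)
    have hp : θ.apply t ++ θ.apply w = w ++ t := by
      rw [← Antimorphism.apply_append]; exact ht.1
    refine List.suffix_of_suffix_length_le (l₃ := w ++ t) (List.suffix_append _ _)
      (hp ▸ List.suffix_append _ _) ?_
    simpa using hlen
  obtain ⟨t, rfl⟩ := h.2.1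
  obtain ⟨t', rfl⟩ := h'.2.1
  have hl : t.length = t'.length := by
    have h1 := h.2.2 _ h'.1 h'.2.1
    have h2 := h'.2.2 _ h.1 h.2.1
    simp only [List.length_append] at h1 h2
    omega
  have hs : t <:+ t' := List.suffix_of_suffix_length_le (key t h) (key t' h') hl.le
  rw [hs.eq_of_length hl]

theorem exists_isClosure (θ : Antimorphism) (w : List Bool) : ∃ v, IsClosure θ w v := by
  classical
  have hex : ∃ n : ℕ, ∃ v : List Bool, v.length = n ∧ IsPalindrome θ v ∧ w <+: v :=
    ⟨_, w ++ θ.apply w, rfl, isPalindrome_append_apply θ w, List.prefix_append _ _⟩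
  obtain ⟨v, hv, hp, hw⟩ := Nat.find_spec hex
  exact ⟨v, hp, hw, fun v' hp' hw' => hv ▸ Nat.find_min' hex ⟨v', rfl, hp', hw'⟩⟩

/-- The closure `w^θ`: the shortest `θ`-palindrome having `w` as a prefix. -/
noncomputable def closure (θ : Antimorphism) (w : List Bool) : List Bool :=
  (exists_isClosure θ w).choose

theorem isClosure_closure (θ : Antimorphism) (w : List Bool) : IsClosure θ w (closure θ w) :=
  (exists_isClosure θ w).choose_spec

theorem closure_eq_iff (θ : Antimorphism) (w v : List Bool) :
    closure θ w = v ↔ IsClosure θ w v :=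
  ⟨fun h => h ▸ isClosure_closure θ w, fun h => (isClosure_closure θ w).eq h⟩

/-- The words `w_n`: `w_0 = ε` and `w_{n+1} = (w_n δ_{n+1})^{ϑ_{n+1}}`. The directive sequences
are indexed from `0` here, so that `Δ n` is `δ_{n+1}` and `Θ n` is `ϑ_{n+1}`. -/
noncomputable def prefixWord (Δ : ℕ → Bool) (Θ : ℕ → Antimorphism) : ℕ → List Bool
  | 0 => []
  | n + 1 => closure (Θ n) (prefixWord Δ Θ n ++ [Δ n])

theorem prefixWord_append_prefix (Δ : ℕ → Bool) (Θ : ℕ → Antimorphism) (n : ℕ) :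
    prefixWord Δ Θ n ++ [Δ n] <+: prefixWord Δ Θ (n + 1) :=
  (isClosure_closure _ _).2.1

theorem prefixWord_prefix (Δ : ℕ → Bool) (Θ : ℕ → Antimorphism) {m n : ℕ} (h : m ≤ n) :
    prefixWord Δ Θ m <+: prefixWord Δ Θ n := by
  induction n, h using Nat.le_induction with
  | base => exact List.prefix_rfl
  | succ n _ ih =>
    exact (ih.trans (List.prefix_append _ _)).trans (prefixWord_append_prefix Δ Θ n)

theorem le_length_prefixWord (Δ : ℕ → Bool) (Θ : ℕ → Antimorphism) (n : ℕ) :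
    n ≤ (prefixWord Δ Θ n).length := by
  induction n with
  | zero => exact Nat.zero_le _
  | succ n ih =>
    have h := (prefixWord_append_prefix Δ Θ n).length_le
    simp only [List.length_append, List.length_singleton] at h
    omega

/-- The generalized pseudostandard word `u(Δ, Θ)`: the infinite word that has all the words
`w_n` as prefixes. -/
noncomputable def word (Δ : ℕ → Bool) (Θ : ℕ → Antimorphism) (i : ℕ) : Bool :=
  (prefixWord Δ Θ (i + 1))[i]'(le_length_prefixWord Δ Θ (i + 1))

/-- Every `w_n` is a prefix of `u(Δ, Θ)`. -/
theorem prefixWord_getElem (Δ : ℕ → Bool) (Θ : ℕ → Antimorphism) (n i : ℕ)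
    (hi : i < (prefixWord Δ Θ n).length) : (prefixWord Δ Θ n)[i] = word Δ Θ i := by
  unfold word
  rcases le_total n (i + 1) with h | h
  · exact (prefixWord_prefix Δ Θ h).getElem hi
  · exact ((prefixWord_prefix Δ Θ h).getElem (le_length_prefixWord Δ Θ (i + 1))).symm

/-- The periodic sequence `v^ω = v v v ⋯` for a non-empty finite sequence `v`. -/
def omegaPower {α : Type} (v : List α) (hv : v ≠ []) (n : ℕ) : α :=
  v[n % v.length]'(Nat.mod_lt _ (List.length_pos_iff.mpr hv))

/-- `v` is a factor of `u`: `v = u_i u_{i+1} ⋯ u_{i+|v|-1}` for some `i`. -/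
def IsFactor (u : ℕ → Bool) (v : List Bool) : Prop :=
  ∃ i : ℕ, v = List.ofFn (fun j : Fin v.length => u (i + j))

/-- The factor complexity of `u`: the number of factors of `u` of length `n`. -/
noncomputable def complexity (u : ℕ → Bool) (n : ℕ) : ℕ :=
  {v : List Bool | IsFactor u v ∧ v.length = n}.ncard

theorem finite_factors (u : ℕ → Bool) (n : ℕ) :
    {v : List Bool | IsFactor u v ∧ v.length = n}.Finite :=
  (List.finite_length_eq Bool n).subset fun _ h => h.2

end GenPseudostandard

/-! The first difference of the complexity is bounded below by the number of left special factors,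
that is, factors that both letters can precede. Every prefix of `u` is left special, and so is its
letterwise complement, because the factors are closed under `E` and `R`. This gives a difference of
at least 2. Each left special word that follows `u` for a while and then leaves it adds itself and
its complement, hence 2 more.

Such branches come from palindromic factors whose two neighbours do not mirror each other. One
family leaves `u` at index `B j` (`branches_B`), another at `D j` (`branches_D`). Their lengths
cover every `n ≥ 3`, so from there on the difference is at least 4. For `6 ≤ n ≤ 9` the branches at
`B 0 = 2` and `D 0 = 5` coexist and the difference is at least 6. Summing gives at least 42 factors
of length 10, and the excess over `4 * n` is never lost (`complexity_succ_ge`,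
`four_mul_lt_complexity`).

The branches need the exact lengths of the `w_n`, which are given by `lengthRec`. A closure is
determined by the longest suitable palindromic suffix, equivalently by a shorter palindromic prefix
and the letter after it. The recurrences are therefore proved by induction together with a list of
all palindromic prefixes: the `w_n` and the exceptional `1` and `101`. -/

namespace GenPseudostandard

/-! ### Closures expressed through letters and lengths -/

/-- The antimorphisms as Booleans: `true` stands for `E`, which exchanges the letters. -/
def Antimorphism.exchanges : Antimorphism → Bool
  | .E => true
  | .R => false

/-- The prefix of length `l` of `u` is a palindrome, for `E` if `b = true` and for `R` if
`b = false`. -/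
def PalPrefix (u : ℕ → Bool) (b : Bool) (l : ℕ) : Prop :=
  ∀ i j, i + j + 1 = l → u j = xor (u i) b

theorem palPrefix_zero (u : ℕ → Bool) (b : Bool) : PalPrefix u b 0 := by
  intro i j h; omega

theorem isPalindrome_ofFn_iff (θ : Antimorphism) (u : ℕ → Bool) (l : ℕ) :
    IsPalindrome θ (List.ofFn fun i : Fin l => u i) ↔ PalPrefix u θ.exchanges l := by
  have key : ∀ i (hi : i < l),
      (θ.apply (List.ofFn fun i : Fin l => u i))[i]'(by
        simpa [Antimorphism.length_apply] using hi) = xor (u (l - 1 - i)) θ.exchanges := by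
    intro i hi
    cases θ <;> simp [Antimorphism.apply, Antimorphism.exchanges]
  constructor
  · intro h i j hij
    have h1 := key j (by omega)
    rw [show l - 1 - j = i by omega] at h1
    rw [← h1]
    simp [show θ.apply _ = _ from h]
  · intro h
    refine List.ext_getElem (by simp [Antimorphism.length_apply]) fun i h1 h2 => ?_
    have hi : i < l := by simpa using h2
    rw [key i hi, ← h (l - 1 - i) i (by omega)]
    simp

theorem prefixWord_eq_ofFn (Δ : ℕ → Bool) (Θ : ℕ → Antimorphism) (n : ℕ) :
    prefixWord Δ Θ n = List.ofFn fun i : Fin (prefixWord Δ Θ n).length => word Δ Θ i := by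
  refine List.ext_getElem (by simp) fun i h1 h2 => ?_
  simp [prefixWord_getElem Δ Θ n i h1]

theorem length_prefixWord_lt_succ (Δ : ℕ → Bool) (Θ : ℕ → Antimorphism) (n : ℕ) :
    (prefixWord Δ Θ n).length < (prefixWord Δ Θ (n + 1)).length := by
  have h := (prefixWord_append_prefix Δ Θ n).length_le
  simpa using h

theorem word_length_prefixWord (Δ : ℕ → Bool) (Θ : ℕ → Antimorphism) (n : ℕ) :
    word Δ Θ (prefixWord Δ Θ n).length = Δ n := by
  rw [← prefixWord_getElem Δ Θ (n + 1) _ (length_prefixWord_lt_succ Δ Θ n),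
    ← (prefixWord_append_prefix Δ Θ n).getElem (by simp)]
  simp

theorem palPrefix_length_prefixWord (Δ : ℕ → Bool) (Θ : ℕ → Antimorphism) (n : ℕ) :
    PalPrefix (word Δ Θ) (Θ n).exchanges (prefixWord Δ Θ (n + 1)).length := by
  rw [← isPalindrome_ofFn_iff, ← prefixWord_eq_ofFn]
  exact (isClosure_closure _ _).1

/-- The competitor `v` is arbitrary beyond the letters of `w_n δ_{n+1}`, since upper bounds on the
closure come from palindromes not yet known to be prefixes of the word. -/
theorem length_prefixWord_succ_le (Δ : ℕ → Bool) (Θ : ℕ → Antimorphism) (n : ℕ)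
    (v : ℕ → Bool) (l : ℕ) (hl : (prefixWord Δ Θ n).length < l)
    (hv : ∀ i ≤ (prefixWord Δ Θ n).length, v i = word Δ Θ i)
    (hp : PalPrefix v (Θ n).exchanges l) : (prefixWord Δ Θ (n + 1)).length ≤ l := by
  have h := (isClosure_closure (Θ n) (prefixWord Δ Θ n ++ [Δ n])).2.2
    (List.ofFn fun i : Fin l => v i) ((isPalindrome_ofFn_iff _ _ _).2 hp) ?_
  · simpa [prefixWord] using h
  · rw [List.prefix_iff_eq_take]
    refine List.ext_getElem (by simp; omega) fun i h1 h2 => ?_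
    have hi : i ≤ (prefixWord Δ Θ n).length := by
      simp at h1; omega
    rw [(prefixWord_append_prefix Δ Θ n).getElem h1, prefixWord_getElem]
    simp [hv i hi]

/-- The properties of `u(1^ω, Θ)`, with `b n` for the type of the closure that leads to the
prefix of length `L (n + 1)`, in terms of the letters of the word. -/
structure IsPseudostandard (u : ℕ → Bool) (b : ℕ → Bool) (L : ℕ → ℕ) : Prop where
  zero : L 0 = 0
  lt_succ : ∀ n, L n < L (n + 1)
  letter : ∀ n, u (L n) = true
  pal : ∀ n, PalPrefix u (b n) (L (n + 1))
  le_of_pal : ∀ n v l, L n < l → (∀ i ≤ L n, v i = u i) → PalPrefix v (b n) l → L (n + 1) ≤ l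

theorem isPseudostandard_word (Δ : ℕ → Bool) (Θ : ℕ → Antimorphism) (hΔ : ∀ n, Δ n = true) :
    IsPseudostandard (word Δ Θ) (fun n => (Θ n).exchanges)
      (fun n => (prefixWord Δ Θ n).length) where
  zero := rfl
  lt_succ := length_prefixWord_lt_succ Δ Θ
  letter n := (word_length_prefixWord Δ Θ n).trans (hΔ n)
  pal := palPrefix_length_prefixWord Δ Θ
  le_of_pal := length_prefixWord_succ_le Δ Θ

/-! ### Composing the reflections of two palindromic prefixes -/

/-- A palindromic prefix of length `l` has, around its centre, a palindrome that is mirrored to a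
prefix by a shorter palindromic prefix. -/
theorem PalPrefix.center {u : ℕ → Bool} {b b' : Bool} {l N : ℕ} (hl : PalPrefix u b l)
    (hN : PalPrefix u b' N) (hlt : N < l) (hle : l ≤ 2 * N + 2) (hu : u N = true) :
    l = 2 * N + 2 ∨ (l = 2 * N + 1 ∧ b = false) ∨
      ∃ k, l + k = 2 * N ∧ PalPrefix u b k ∧ u k = !(xor b b') := by
  rcases (show l = 2 * N + 2 ∨ l = 2 * N + 1 ∨ l ≤ 2 * N by omega) with h | h | h
  · exact .inl h
  · refine .inr (.inl ⟨h, ?_⟩)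
    have := hl N N (by omega)
    rw [hu] at this
    cases b
    · rfl
    · exact absurd this (by decide)
  · obtain ⟨k, hk⟩ := Nat.exists_eq_add_of_le h
    refine .inr (.inr ⟨k, hk.symm, ?_, ?_⟩)
    · intro i j hij
      have h1 := hN i (N - 1 - i) (by omega)
      have h2 := hl (N - 1 - i) (N - k + i) (by omega)
      have h3 := hN (N - k + i) j (by omega)
      rw [h3, h2, h1]
      cases u i <;> cases b <;> cases b' <;> rfl
    · have h1 := hl N (N - 1 - k) (by omega)
      have h2 := hN (N - 1 - k) k (by omega)
      rw [h2, h1, hu]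
      cases b <;> cases b' <;> rfl

/-- The letters that follow a palindromic prefix inside a longer one. -/
theorem PalPrefix.continuation {u : ℕ → Bool} {b b' : Bool} {l N k : ℕ} (hl : PalPrefix u b l)
    (hN : PalPrefix u b' N) (h : l + k = 2 * N) (i : ℕ) (hi : k + i < N) :
    u (N + i) = xor (u (k + i)) (xor b b') := by
  have h1 := hl (N - 1 - k - i) (N + i) (by omega)
  have h2 := hN (k + i) (N - 1 - k - i) (by omega)
  rw [h1, h2]
  cases u (k + i) <;> cases b <;> cases b' <;> rfl

namespace IsPseudostandard

variable {u b : ℕ → Bool} {L : ℕ → ℕ}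

/-- The competitor is `w_n 1` followed by its own image. -/
theorem length_succ_le_double (h : IsPseudostandard u b L) (n : ℕ) : L (n + 1) ≤ 2 * L n + 2 := by
  refine h.le_of_pal n (fun i => if i ≤ L n then u i else xor (u (2 * L n + 1 - i)) (b n)) _
    (by omega) (fun i hi => if_pos hi) fun i j hij => ?_
  dsimp only
  rcases le_or_gt i (L n) with hi | hi
  · rw [if_pos hi, if_neg (by omega), show 2 * L n + 1 - j = i by omega]
  · rw [if_pos (show j ≤ L n by omega), if_neg (by omega), show 2 * L n + 1 - i = j by omega]
    cases u j <;> cases b n <;> rfl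

/-- Reflecting the prefix of length `k` gives a palindromic suffix of `w_n`. The condition on `u k`
says that the letter before this suffix matches the appended `1`, so the closure can be centred
there. -/
theorem length_succ_le_of_pal (h : IsPseudostandard u b L) {n k : ℕ} {b' : Bool}
    (hN : PalPrefix u b' (L n)) (hk : PalPrefix u (b n) k) (hkn : k < L n)
    (hu : u k = !(xor (b n) b')) : L (n + 1) + k ≤ 2 * L n := by
  have hlet := h.letter n
  suffices L (n + 1) ≤ 2 * L n - k by omega
  refine h.le_of_pal n (fun i => if i ≤ L n then u i else xor (u (2 * L n - k - 1 - i)) (b n)) _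
    (by omega) (fun i hi => if_pos hi) fun i j hij => ?_
  dsimp only
  have inner : ∀ i j, i + j + 1 = 2 * L n - k → i ≤ L n → j ≤ L n → i ≤ j →
      u j = xor (u i) (b n) := by
    intro i j hij hi hj hle
    rcases hj.eq_or_lt with hj | hj
    · have h1 := hN i k (by omega)
      rw [hj, hlet]
      revert h1
      rw [hu]
      cases u i <;> cases b n <;> cases b' <;> decide
    · have h1 := hN i (L n - 1 - i) (by omega)
      have h2 := hk (L n - 1 - i) (L n - 1 - j) (by omega)
      have h3 := hN (L n - 1 - j) j (by omega)
      rw [h3, h2, h1]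
      cases u i <;> cases b n <;> cases b' <;> rfl
  rcases le_or_gt i (L n) with hi | hi <;> rcases le_or_gt j (L n) with hj | hj
  · rw [if_pos hi, if_pos hj]
    rcases le_total i j with hle | hle
    · exact inner i j hij hi hj hle
    · rw [inner j i (by omega) hj hi hle]
      cases u j <;> cases b n <;> rfl
  · rw [if_pos hi, if_neg (by omega), show 2 * L n - k - 1 - j = i by omega]
  · rw [if_pos hj, if_neg (by omega), show 2 * L n - k - 1 - i = j by omega]
    cases u j <;> cases b n <;> rfl
  · omega

end IsPseudostandard

/-! ### Lengths and palindromic prefixes for `(EERR)^ω` -/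

/-- A prefix of length `N`, a palindrome of type `b`, is followed by the letter `1`, and the
closure of type `b'` of the two together has length `N'`. -/
structure ClosureStep (u : ℕ → Bool) (b b' : Bool) (N N' : ℕ) : Prop where
  lt : N < N'
  letter : u N = true
  pal : PalPrefix u b N
  pal' : PalPrefix u b' N'
  le_double : N' ≤ 2 * N + 2
  le_of_pal : ∀ l, N < l → PalPrefix u b' l → N' ≤ l
  add_le_of_pal : ∀ k, k < N → PalPrefix u b' k → u k = !(xor b' b) → N' + k ≤ 2 * N

theorem IsPseudostandard.closureStep {u b : ℕ → Bool} {L : ℕ → ℕ} (h : IsPseudostandard u b L)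
    (n : ℕ) (c : Bool) (hc : PalPrefix u c (L n)) : ClosureStep u c (b n) (L n) (L (n + 1)) where
  lt := h.lt_succ n
  letter := h.letter n
  pal := hc
  pal' := h.pal n
  le_double := h.length_succ_le_double n
  le_of_pal l hl hp := h.le_of_pal n u l hl (fun _ _ => rfl) hp
  add_le_of_pal _ hk hp hu := h.length_succ_le_of_pal hc hp hk hu

/-- The word with directive sequences `1^ω` and `(EERR)^ω`; its prefixes `w_n` have the lengths
`A j`, `B j`, `C j`, `D j` for `n = 4j`, `4j+1`, `4j+2`, `4j+3`. -/
structure IsEERR (u : ℕ → Bool) (A B C D : ℕ → ℕ) : Prop where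
  zero : A 0 = 0
  stepB : ∀ j, ClosureStep u false true (A j) (B j)
  stepC : ∀ j, ClosureStep u true true (B j) (C j)
  stepD : ∀ j, ClosureStep u true false (C j) (D j)
  stepA : ∀ j, ClosureStep u false false (D j) (A (j + 1))

theorem IsPseudostandard.isEERR {u b : ℕ → Bool} {L : ℕ → ℕ} (h : IsPseudostandard u b L)
    (b0 : ∀ j, b (4 * j) = true) (b1 : ∀ j, b (4 * j + 1) = true)
    (b2 : ∀ j, b (4 * j + 2) = false) (b3 : ∀ j, b (4 * j + 3) = false) :
    IsEERR u (fun j => L (4 * j)) (fun j => L (4 * j + 1)) (fun j => L (4 * j + 2))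
      (fun j => L (4 * j + 3)) where
  zero := h.zero
  stepB j := by
    refine b0 j ▸ h.closureStep (4 * j) false ?_
    rcases j with _ | j
    · rw [Nat.mul_zero, h.zero]
      exact palPrefix_zero u _
    · exact b3 j ▸ h.pal (4 * j + 3)
  stepC j := b1 j ▸ h.closureStep (4 * j + 1) true (b0 j ▸ h.pal (4 * j))
  stepD j := b2 j ▸ h.closureStep (4 * j + 2) true (b1 j ▸ h.pal (4 * j + 1))
  stepA j := by
    have := h.closureStep (4 * j + 3) false (b2 j ▸ h.pal (4 * j + 2))
    rwa [b3 j] at this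

/-- The length that precedes `C j` in the sequence `0, C 0, C 1, …`. -/
def prevLength (C : ℕ → ℕ) : ℕ → ℕ
  | 0 => 0
  | j + 1 => C j

/-- The palindromic prefixes of length at most `M` are the words `w_n` and `1`, `101`. -/
structure PalClassified (u : ℕ → Bool) (A B C D : ℕ → ℕ) (M : ℕ) : Prop where
  exchange : ∀ l ≤ M, PalPrefix u true l → l = 0 ∨ ∃ i, l = B i ∨ l = C i
  reversal : ∀ l ≤ M, PalPrefix u false l → l = 1 ∨ l = 3 ∨ ∃ i, l = A i ∨ l = D i

/-- The recurrences for the lengths. -/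
structure LengthRec (A B C D : ℕ → ℕ) (j : ℕ) : Prop where
  recB : B j = 2 * A j + 2
  recC : C j + prevLength C j = 2 * B j
  recD : D j + 3 = 2 * C j
  recA : A (j + 1) + A j = 2 * D j

theorem PalPrefix.eq_zero {u : ℕ → Bool} {l : ℕ} (h : PalPrefix u true l)
    (h' : PalPrefix u false l) : l = 0 := by
  by_contra h0
  have h1 := h 0 (l - 1) (by omega)
  have h2 := h' 0 (l - 1) (by omega)
  rw [h1] at h2
  revert h2
  cases u 0 <;> decide

namespace IsEERR

variable {u : ℕ → Bool} {A B C D : ℕ → ℕ}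

theorem monotone (h : IsEERR u A B C D) : Monotone A := by
  refine monotone_nat_of_le_succ fun j => ?_
  have := (h.stepB j).lt
  have := (h.stepC j).lt
  have := (h.stepD j).lt
  have := (h.stepA j).lt
  omega

/-- The comparisons between the lengths with two indices. -/
theorem lt_of_lt (h : IsEERR u A B C D) {i j : ℕ} (hij : i < j) :
    A i < B i ∧ B i < C i ∧ C i < D i ∧ D i < A j :=
  ⟨(h.stepB i).lt, (h.stepC i).lt, (h.stepD i).lt, (h.stepA i).lt.trans_le (h.monotone hij)⟩

theorem letter_zero (h : IsEERR u A B C D) : u 0 = true := h.zero ▸ (h.stepB 0).letter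

theorem palPrefix_prev (h : IsEERR u A B C D) (j : ℕ) :
    PalPrefix u true (prevLength C j) ∧ u (prevLength C j) = true ∧ prevLength C j ≤ A j := by
  rcases j with _ | j
  · exact ⟨palPrefix_zero u _, h.letter_zero, Nat.zero_le _⟩
  · exact ⟨(h.stepC j).pal', (h.stepD j).letter,
      ((h.stepD j).lt.trans (h.stepA j).lt).le⟩

theorem letter_A_succ (h : IsEERR u A B C D) {j : ℕ} (hB : B j = 2 * A j + 2) :
    u (A j + 1) = false := by
  rw [(h.stepB j).pal' (A j) (A j + 1) (by omega), (h.stepB j).letter]; rfl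

/-- The closure is `w 1 0 E(w)`, and `E(w)` is the complement of `w` because `w` is an
`R`-palindrome. -/
theorem after_A (h : IsEERR u A B C D) {j : ℕ} (hB : B j = 2 * A j + 2) {i : ℕ} (hi : i < A j) :
    u (A j + 2 + i) = !u i := by
  rw [(h.stepB j).pal' (A j - 1 - i) (A j + 2 + i) (by omega),
    (h.stepB j).pal i (A j - 1 - i) (by omega)]
  cases u i <;> rfl

theorem after_B (h : IsEERR u A B C D) {j : ℕ} (hC : C j + prevLength C j = 2 * B j) {i : ℕ}
    (hi : prevLength C j + i < B j) : u (B j + i) = u (prevLength C j + i) := by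
  rw [(h.stepC j).pal'.continuation (h.stepC j).pal hC i hi]; simp

theorem after_C (h : IsEERR u A B C D) {j : ℕ} (hD : D j + 3 = 2 * C j) {i : ℕ}
    (hi : 3 + i < C j) : u (C j + i) = !u (3 + i) := by
  rw [(h.stepD j).pal'.continuation (h.stepD j).pal hD i hi]; simp

theorem after_D (h : IsEERR u A B C D) {j : ℕ} (hA : A (j + 1) + A j = 2 * D j) {i : ℕ}
    (hi : A j + i < D j) : u (D j + i) = u (A j + i) := by
  rw [(h.stepA j).pal'.continuation (h.stepA j).pal hA i hi]; simp

/-- The word starts with `1010`. The `R`-palindrome `101`, followed by `0`, is not among the `w_n`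
and causes the constant 3 in the recurrence for `D`. -/
theorem first_letters (h : IsEERR u A B C D) (hB : B 0 = 2) (hC : C 0 = 4) :
    u 1 = false ∧ u 3 = false ∧ PalPrefix u false 3 := by
  have h0 := h.letter_zero
  have h1 := (h.stepB 0).pal' 0 1 (by omega)
  have h2 := (h.stepC 0).pal' 1 2 (by omega)
  have h3 := (h.stepC 0).pal' 0 3 (by omega)
  rw [h0] at h1 h3
  rw [h1] at h2
  refine ⟨h1, h3, fun i j hij => ?_⟩
  obtain ⟨rfl, rfl⟩ | ⟨rfl, rfl⟩ | ⟨rfl, rfl⟩ :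
      (i = 0 ∧ j = 2) ∨ (i = 1 ∧ j = 1) ∨ (i = 2 ∧ j = 0) := by omega
  · rw [h0, h2]; rfl
  · simp
  · rw [h0, h2]; rfl

/-- A shorter closure would need an `E`-palindromic prefix followed by `0`, but all those known are
followed by `1`. A new `R`-palindrome would come from some `A i` or `D i`, whose continuation
contradicts `after_A`. -/
theorem classify_B (h : IsEERR u A B C D) {j : ℕ} (hrec : ∀ i < j, LengthRec A B C D i)
    (hcl : PalClassified u A B C D (A j)) :
    B j = 2 * A j + 2 ∧ PalClassified u A B C D (B j) := by
  have s := h.stepB j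
  have hB : B j = 2 * A j + 2 := by
    rcases s.pal'.center s.pal s.lt s.le_double s.letter with h1 | h1 | ⟨k, hk, hp, hu⟩
    · exact h1
    · exact absurd h1.2 (by decide)
    · exfalso
      have hlt := s.lt
      rcases hcl.exchange k (by omega) hp with rfl | ⟨i, rfl | rfl⟩
      · rw [h.letter_zero] at hu; exact absurd hu (by decide)
      · rw [(h.stepC i).letter] at hu; exact absurd hu (by decide)
      · rw [(h.stepD i).letter] at hu; exact absurd hu (by decide)
  refine ⟨hB, ⟨fun l hl hp => ?_, fun l hl hp => ?_⟩⟩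
  · rcases le_or_gt l (A j) with hle | hgt
    · exact hcl.exchange l hle hp
    · exact .inr ⟨j, .inl (le_antisymm hl (s.le_of_pal l hgt hp))⟩
  · rcases le_or_gt l (A j) with hle | hgt
    · exact hcl.reversal l hle hp
    rcases hl.eq_or_lt with rfl | hl
    · have := s.pal'.eq_zero hp
      omega
    rcases Nat.eq_zero_or_pos j with rfl | hj
    · have := h.zero
      exact .inl (by omega)
    exfalso
    have r0 := hrec 0 hj
    have hz := h.zero
    obtain ⟨u1, u3, -⟩ := h.first_letters (by have := r0.recB; omega) (by
      have h1 := r0.recB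
      have h2 := r0.recC
      simp only [prevLength] at h2
      omega)
    rcases hp.center s.pal hgt (by omega) s.letter with h1 | h1 | ⟨k, hk, hpk, hu⟩
    · omega
    · have hpos := h.lt_of_lt hj
      have e1 := hp (A j - 1) (A j + 1) (by omega)
      rw [h.letter_A_succ hB, s.pal 0 (A j - 1) (by omega), h.letter_zero] at e1
      exact absurd e1 (by decide)
    · have cont := hp.continuation s.pal hk
      rcases hcl.reversal k (by omega) hpk with rfl | rfl | ⟨i, rfl | rfl⟩
      · rw [u1] at hu; exact absurd hu (by decide)
      · rw [u3] at hu; exact absurd hu (by decide)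
      · have hij : i < j := by
          by_contra hc
          have := h.monotone (not_lt.1 hc)
          omega
        have o := h.lt_of_lt hij
        have r := hrec i hij
        -- At this offset `after_A` gives the complement of `u (A i)`, which is `0`, while the
        -- continuation gives `u (B i)`, which is `1`.
        have e := cont (A i + 2) (by have := r.recB; omega)
        rw [show A j + (A i + 2) = A j + 2 + A i by omega, h.after_A hB (by omega),
          (h.stepB i).letter, show A i + (A i + 2) = B i by have := r.recB; omega,
          (h.stepC i).letter] at e
        exact absurd e (by decide)
      · have hij : i < j := by
          by_contra hc
          have := h.monotone (not_lt.1 hc)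
          have := h.lt_of_lt (Nat.lt_add_one i)
          omega
        have o := h.lt_of_lt hij
        have r := hrec i hij
        have hm := h.monotone (show i + 1 ≤ j from hij)
        have e := cont (A i + 2) (by have := r.recB; have := r.recA; omega)
        rw [show A j + (A i + 2) = A j + 2 + A i by omega, h.after_A hB (by omega),
          (h.stepB i).letter, h.after_D r.recA (by have := r.recB; omega),
          show A i + (A i + 2) = B i by have := r.recB; omega,
          (h.stepC i).letter] at e
        exact absurd e (by decide)

/-- The core must be an `E`-palindrome followed by `1`; the longest admissible one is the previous
`C`, or empty for `j = 0`. A new `R`-palindrome needs a core followed by `0`, which only yields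
`101` when `j = 0`. -/
theorem classify_C (h : IsEERR u A B C D) {j : ℕ} (hrec : ∀ i < j, LengthRec A B C D i)
    (hB : B j = 2 * A j + 2) (hcl : PalClassified u A B C D (B j)) :
    C j + prevLength C j = 2 * B j ∧ PalClassified u A B C D (C j) := by
  have s := h.stepC j
  have hlt := s.lt
  obtain ⟨p1, p2, p3⟩ := h.palPrefix_prev j
  have hle := s.add_le_of_pal _ (by omega) p1 p2
  have hC : C j + prevLength C j = 2 * B j := by
    refine le_antisymm hle ?_
    rcases s.pal'.center s.pal s.lt s.le_double s.letter with h1 | h1 | ⟨k, hk, hp, hu⟩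
    · omega
    · omega
    · suffices k ≤ prevLength C j by omega
      have key : ∀ i, k = B i ∨ k = C i → k ≤ prevLength C j := by
        intro i hi
        have hij : i < j := by
          by_contra hc
          have hm := h.monotone (not_lt.1 hc)
          have o := h.lt_of_lt (Nat.lt_add_one i)
          rcases (not_lt.1 hc).eq_or_lt with rfl | hji
          · omega
          · have := h.lt_of_lt hji
            omega
        obtain ⟨j, rfl⟩ : ∃ j', j = j' + 1 := ⟨j - 1, by omega⟩
        simp only [prevLength]
        have o := h.lt_of_lt (Nat.lt_add_one i)
        rcases (Nat.le_of_lt_succ hij).eq_or_lt with rfl | hij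
        · omega
        · have := h.lt_of_lt hij
          have := h.lt_of_lt (Nat.lt_add_one j)
          omega
      rcases hcl.exchange k (by omega) hp with rfl | ⟨i, hi⟩
      · exact Nat.zero_le _
      · exact key i hi
  refine ⟨hC, ⟨fun l hl hp => ?_, fun l hl hp => ?_⟩⟩
  · rcases le_or_gt l (B j) with hle | hgt
    · exact hcl.exchange l hle hp
    · exact .inr ⟨j, .inr (le_antisymm hl (s.le_of_pal l hgt hp))⟩
  · rcases le_or_gt l (B j) with hle | hgt
    · exact hcl.reversal l hle hp
    rcases hl.eq_or_lt with rfl | hl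
    · have := s.pal'.eq_zero hp
      omega
    have hprev : j = 0 ∨ 3 ≤ prevLength C j := by
      rcases j with _ | j
      · exact .inl rfl
      · have := (hrec j (Nat.lt_add_one j)).recB
        have := (h.stepC j).lt
        exact .inr (by simp only [prevLength]; omega)
    have hz := h.zero
    rcases hp.center s.pal hgt (by omega) s.letter with h1 | h1 | ⟨k, hk, hpk, hu⟩
    · omega
    · omega
    · rcases hcl.reversal k (by omega) hpk with rfl | rfl | ⟨i, rfl | rfl⟩
      · rcases hprev with rfl | hprev
        · exact .inr (.inl (by omega))
        · omega
      · rcases hprev with rfl | hprev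
        · omega
        · omega
      · rw [(h.stepB i).letter] at hu; exact absurd hu (by decide)
      · rw [(h.stepA i).letter] at hu; exact absurd hu (by decide)

/-- The core must be an `R`-palindrome followed by `0`, and `101` is the longest. New
`E`-palindromes are refuted at offset `D i - C i`, where `after_C` gives `0` and the continuation
gives `u (D i) = 1`. -/
theorem classify_D (h : IsEERR u A B C D) {j : ℕ} (hrec : ∀ i < j, LengthRec A B C D i)
    (hB : B j = 2 * A j + 2) (hC : C j + prevLength C j = 2 * B j)
    (hcl : PalClassified u A B C D (C j)) :
    D j + 3 = 2 * C j ∧ PalClassified u A B C D (D j) := by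
  have s := h.stepD j
  have hlt := s.lt
  have hz := h.zero
  have hBC : ∀ i ≤ j, B i = 2 * A i + 2 ∧ C i + prevLength C i = 2 * B i := by
    intro i hi
    rcases hi.eq_or_lt with rfl | hi
    · exact ⟨hB, hC⟩
    · exact ⟨(hrec i hi).recB, (hrec i hi).recC⟩
  have hB0 := (hBC 0 (Nat.zero_le _)).1
  have hC0 := (hBC 0 (Nat.zero_le _)).2
  simp only [prevLength] at hC0
  obtain ⟨u1, u3, hp3⟩ := h.first_letters (by omega) (by omega)
  have hC3 : 3 < C j := by
    rcases Nat.eq_zero_or_pos j with rfl | hj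
    · omega
    · have := h.lt_of_lt hj
      have := h.lt_of_lt (Nat.lt_add_one j)
      omega
  have hle := s.add_le_of_pal 3 hC3 hp3 (by rw [u3]; rfl)
  have hD : D j + 3 = 2 * C j := by
    refine le_antisymm hle ?_
    rcases s.pal'.center s.pal s.lt s.le_double s.letter with h1 | h1 | ⟨k, hk, hp, hu⟩
    · omega
    · omega
    · rcases hcl.reversal k (by omega) hp with rfl | rfl | ⟨i, rfl | rfl⟩
      · omega
      · omega
      · rw [(h.stepB i).letter] at hu; exact absurd hu (by decide)
      · rw [(h.stepA i).letter] at hu; exact absurd hu (by decide)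
  refine ⟨hD, ⟨fun l hl hp => ?_, fun l hl hp => ?_⟩⟩
  · rcases le_or_gt l (C j) with hle | hgt
    · exact hcl.exchange l hle hp
    rcases hl.eq_or_lt with rfl | hl
    · have := hp.eq_zero s.pal'
      omega
    exfalso
    rcases hp.center s.pal hgt (by omega) s.letter with h1 | h1 | ⟨k, hk, hpk, hu⟩
    · omega
    · omega
    · have cont := hp.continuation s.pal hk
      rcases hcl.exchange k (by omega) hpk with rfl | ⟨i, rfl | rfl⟩
      · omega
      · rcases i with _ | i
        · omega
        have hij : i + 1 ≤ j := by
          by_contra hc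
          have := h.lt_of_lt (not_le.1 hc)
          have := h.monotone (not_le.1 hc)
          have := h.lt_of_lt (Nat.lt_add_one j)
          have := h.lt_of_lt (Nat.lt_add_one (i + 1))
          omega
        have o := h.lt_of_lt (Nat.lt_add_one i)
        have o' := h.lt_of_lt (Nat.lt_add_one (i + 1))
        have r := hrec i (by omega)
        have rD := r.recD
        have hm := h.monotone hij
        have hj := h.lt_of_lt (Nat.lt_add_one j)
        have e := cont (D i - C i) (by
          have := (h.palPrefix_prev j).2.2
          have := (hBC (i + 1) hij).1
          have := (hBC j le_rfl).1
          omega)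
        rw [h.after_C hD (by omega), show 3 + (D i - C i) = C i by omega, (h.stepD i).letter,
          h.after_B (hBC (i + 1) hij).2 (by simp only [prevLength]; omega)] at e
        simp only [prevLength] at e
        rw [show C i + (D i - C i) = D i by omega, (h.stepA i).letter] at e
        exact absurd e (by decide)
      · have hij : i < j := by
          by_contra hc
          have o := h.lt_of_lt (Nat.lt_add_one i)
          rcases (not_lt.1 hc).eq_or_lt with rfl | hji
          · omega
          · have := h.lt_of_lt hji
            omega
        have o := h.lt_of_lt hij
        have o' := h.lt_of_lt (Nat.lt_add_one j)
        have rD := (hrec i hij).recD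
        have e := cont (D i - C i) (by omega)
        rw [h.after_C hD (by omega), show 3 + (D i - C i) = C i by omega, (h.stepD i).letter,
          show C i + (D i - C i) = D i by omega, (h.stepA i).letter] at e
        exact absurd e (by decide)
  · rcases le_or_gt l (C j) with hle | hgt
    · exact hcl.reversal l hle hp
    · exact .inr (.inr ⟨j, .inr (le_antisymm hl (s.le_of_pal l hgt hp))⟩)

/-- The core must be an `R`-palindrome followed by `1`, and the longest one shorter than `D j` is
that of length `A j`. New `E`-palindromes would need an `E`-core followed by `0`. -/
theorem classify_A (h : IsEERR u A B C D) {j : ℕ} (u1 : u 1 = false) (u3 : u 3 = false)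
    (hcl : PalClassified u A B C D (D j)) :
    A (j + 1) + A j = 2 * D j ∧ PalClassified u A B C D (A (j + 1)) := by
  have s := h.stepA j
  have hlt := s.lt
  have o := h.lt_of_lt (Nat.lt_add_one j)
  have hle := s.add_le_of_pal (A j) (by omega) (h.stepB j).pal (h.stepB j).letter
  have hA : A (j + 1) + A j = 2 * D j := by
    refine le_antisymm hle ?_
    rcases s.pal'.center s.pal s.lt s.le_double s.letter with h1 | h1 | ⟨k, hk, hp, hu⟩
    · omega
    · omega
    · suffices k ≤ A j by omega
      rcases hcl.reversal k (by omega) hp with rfl | rfl | ⟨i, rfl | rfl⟩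
      · rw [u1] at hu; exact absurd hu (by decide)
      · rw [u3] at hu; exact absurd hu (by decide)
      · refine h.monotone (Nat.le_of_not_lt fun hc => ?_)
        have := h.lt_of_lt hc
        omega
      · have hij : i < j := by
          by_contra hc
          have o := h.lt_of_lt (Nat.lt_add_one i)
          rcases (not_lt.1 hc).eq_or_lt with rfl | hji
          · omega
          · have := h.lt_of_lt hji
            omega
        exact (h.lt_of_lt hij).2.2.2.le
  refine ⟨hA, ⟨fun l hl hp => ?_, fun l hl hp => ?_⟩⟩
  · rcases le_or_gt l (D j) with hle | hgt
    · exact hcl.exchange l hle hp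
    exfalso
    rcases hp.center s.pal hgt (by omega) s.letter with h1 | h1 | ⟨k, hk, hpk, hu⟩
    · omega
    · omega
    · rcases hcl.exchange k (by omega) hpk with rfl | ⟨i, rfl | rfl⟩
      · rw [h.letter_zero] at hu; exact absurd hu (by decide)
      · rw [(h.stepC i).letter] at hu; exact absurd hu (by decide)
      · rw [(h.stepD i).letter] at hu; exact absurd hu (by decide)
  · rcases le_or_gt l (D j) with hle | hgt
    · exact hcl.reversal l hle hp
    · exact .inr (.inr ⟨j + 1, .inl (le_antisymm hl (s.le_of_pal l hgt hp))⟩)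

theorem lengthRec (h : IsEERR u A B C D) (j : ℕ) : LengthRec A B C D j := by
  suffices ∀ j, (∀ i < j, LengthRec A B C D i) ∧ PalClassified u A B C D (A j) from
    (this (j + 1)).1 j (Nat.lt_add_one j)
  intro j
  induction j with
  | zero =>
    refine ⟨fun i hi => absurd hi (Nat.not_lt_zero i), fun l hl _ => .inl ?_, fun l hl _ =>
      .inr (.inr ⟨0, .inl ?_⟩)⟩
    · have := h.zero
      omega
    · have := h.zero
      omega
  | succ j ih =>
    obtain ⟨hrec, h0⟩ := ih
    obtain ⟨rB, h1⟩ := h.classify_B hrec h0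
    obtain ⟨rC, h2⟩ := h.classify_C hrec rB h1
    obtain ⟨rD, h3⟩ := h.classify_D hrec rB rC h2
    have hB0 : B 0 = 2 * A 0 + 2 ∧ C 0 + 0 = 2 * B 0 := by
      rcases Nat.eq_zero_or_pos j with rfl | hj
      · exact ⟨rB, rC⟩
      · exact ⟨(hrec 0 hj).recB, (hrec 0 hj).recC⟩
    have hz := h.zero
    obtain ⟨u1, u3, -⟩ := h.first_letters (by omega) (by omega)
    obtain ⟨rA, h4⟩ := h.classify_A u1 u3 h3
    refine ⟨fun i hi => ?_, h4⟩
    rcases (Nat.le_of_lt_succ hi).eq_or_lt with rfl | hi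
    · exact ⟨rB, rC, rD, rA⟩
    · exact hrec i hi

end IsEERR

/-! ### Left special factors and the growth of complexity -/

/-- Both letters can precede the prefix of length `n` of `z` in `u`. -/
def LeftSpecial (u z : ℕ → Bool) (n : ℕ) : Prop :=
  ∀ a, ∃ p, u p = a ∧ ∀ i < n, u (p + 1 + i) = z i

theorem isFactor_and_length_iff (u : ℕ → Bool) (n : ℕ) (v : List Bool) :
    (IsFactor u v ∧ v.length = n) ↔ ∃ p, v = List.ofFn fun i : Fin n => u (p + i) := by
  constructor
  · rintro ⟨⟨p, hp⟩, rfl⟩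
    exact ⟨p, hp⟩
  · rintro ⟨p, rfl⟩
    refine ⟨⟨p, List.ext_getElem (by simp) fun i h1 h2 => by simp⟩, by simp⟩

theorem cons_ofFn_eq {u z : ℕ → Bool} {n p : ℕ} (h : ∀ i < n, u (p + 1 + i) = z i) :
    u p :: List.ofFn (fun i : Fin n => z i) = List.ofFn fun i : Fin (n + 1) => u (p + i) := by
  rw [List.ofFn_succ]
  congr 2
  funext i
  rw [← h i i.2]
  congr 1
  simp only [Fin.val_succ]
  omega

theorem complexity_zero (u : ℕ → Bool) : complexity u 0 = 1 := by
  have : {v : List Bool | IsFactor u v ∧ v.length = 0} = {[]} := by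
    ext v
    simp only [Set.mem_ofPred_eq, isFactor_and_length_iff, List.ofFn_zero, exists_const,
      Set.mem_singleton_iff]
  rw [complexity, this, Set.ncard_singleton]

/-- If every factor of `u` has a left extension, then left special factors increase the
complexity. -/
theorem complexity_add_card_le {ι : Type} [Fintype ι] {u : ℕ → Bool} {n : ℕ} (f : ι → ℕ → Bool)
    (hext : ∀ p, ∃ q, ∀ i < n, u (q + 1 + i) = u (p + i))
    (hf : ∀ a, LeftSpecial u (f a) n)
    (hinj : ∀ a a', (∀ i < n, f a i = f a' i) → a = a') :
    complexity u n + Fintype.card ι ≤ complexity u (n + 1) := by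
  set S : ℕ → Set (List Bool) := fun n => {v : List Bool | IsFactor u v ∧ v.length = n} with hS
  have hmem : ∀ n v, v ∈ S n ↔ ∃ p, v = List.ofFn fun i : Fin n => u (p + i) :=
    fun n v => isFactor_and_length_iff u n v
  have hg : ∀ v ∈ S n, ∃ a, a :: v ∈ S (n + 1) := by
    intro v hv
    obtain ⟨p, rfl⟩ := (hmem n v).1 hv
    obtain ⟨q, hq⟩ := hext p
    exact ⟨u q, (hmem _ _).2 ⟨q, cons_ofFn_eq hq⟩⟩
  choose! g hg using hg
  let w : ι → List Bool := fun a => List.ofFn fun i : Fin n => f a i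
  have hw : ∀ a c, c :: w a ∈ S (n + 1) := by
    intro a c
    obtain ⟨p, rfl, hp⟩ := hf a c
    exact (hmem _ _).2 ⟨p, cons_ofFn_eq hp⟩
  have hwinj : Function.Injective w := by
    intro a a' h
    refine hinj a a' fun i hi => ?_
    exact congrFun (List.ofFn_injective h) ⟨i, hi⟩
  have : Finite (S n) := finite_factors u n
  have : Finite (S (n + 1)) := finite_factors u (n + 1)
  -- Each factor gets one chosen left extension; a left special one also gets the other.
  let φ : S n ⊕ ι → S (n + 1) := Sum.elim (fun v => ⟨g v :: v, hg v v.2⟩)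
    fun a => ⟨(!g (w a)) :: w a, hw a _⟩
  have hφ : Function.Injective φ := by
    rintro (v | a) (v' | a') h <;> simp only [φ, Sum.elim_inl, Sum.elim_inr, Subtype.mk.injEq,
      List.cons.injEq] at h
    · exact congrArg _ (Subtype.ext h.2)
    · rw [h.2] at h
      exact absurd h.1 (by simp)
    · rw [h.2] at h
      exact absurd h.1 (by simp)
    · exact congrArg _ (hwinj h.2)
  have := Nat.card_le_card_of_injective φ hφ
  rw [Nat.card_sum, Nat.card_eq_fintype_card (α := ι)] at this
  exact this

/-- Some left special word of length `n` agrees with `u` on the first `N` letters, but not on the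
next one. -/
def Branches (u : ℕ → Bool) (N n : ℕ) : Prop :=
  ∃ z, LeftSpecial u z n ∧ (∀ i < N, z i = u i) ∧ z N ≠ u N

theorem LeftSpecial.mono {u z : ℕ → Bool} {m n : ℕ} (h : LeftSpecial u z n) (hmn : m ≤ n) :
    LeftSpecial u z m := fun a =>
  let ⟨p, hp, hz⟩ := h a
  ⟨p, hp, fun i hi => hz i (hi.trans_le hmn)⟩

theorem Branches.mono {u : ℕ → Bool} {N m n : ℕ} (h : Branches u N n) (hmn : m ≤ n) :
    Branches u N m :=
  let ⟨z, hz, h1, h2⟩ := h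
  ⟨z, hz.mono hmn, h1, h2⟩

/-! ### Two families of branches -/

namespace IsEERR

variable {u : ℕ → Bool} {A B C D : ℕ → ℕ}

theorem le_A (h : IsEERR u A B C D) (j : ℕ) : j ≤ A j := by
  induction j with
  | zero => exact Nat.zero_le _
  | succ j ih =>
    have := h.lt_of_lt (Nat.lt_add_one j)
    omega

theorem exists_long_pal (h : IsEERR u A B C D) (c : Bool) (n : ℕ) :
    ∃ N, n ≤ N ∧ PalPrefix u c N ∧ u N = true := by
  have h1 := h.le_A n
  have h2 := (h.stepB n).lt
  cases c
  · exact ⟨A n, h1, (h.stepB n).pal, (h.stepB n).letter⟩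
  · exact ⟨B n, by omega, (h.stepC n).pal, (h.stepC n).letter⟩

/-- The set of factors is closed under `E` and `R`. -/
theorem exists_mirror (h : IsEERR u A B C D) (c : Bool) (p n : ℕ) :
    ∃ q, 0 < q ∧ ∀ x y, x + y + 1 = n → u (q + x) = xor (u (p + y)) c := by
  obtain ⟨N, hN, hp, -⟩ := h.exists_long_pal c (p + n + 1)
  exact ⟨N - (p + n), by omega, fun x y hxy => hp _ _ (by omega)⟩

theorem exists_left_extension (h : IsEERR u A B C D) (n p : ℕ) :
    ∃ q, ∀ i < n, u (q + 1 + i) = u (p + i) := by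
  obtain ⟨q, -, hq⟩ := h.exists_mirror false p n
  obtain ⟨r, hr, hr'⟩ := h.exists_mirror false q n
  refine ⟨r - 1, fun i hi => ?_⟩
  rw [Nat.sub_add_cancel hr, hr' i (n - 1 - i) (by omega), hq (n - 1 - i) i (by omega)]
  simp

/-- The image of a long palindromic prefix together with its next letter `1` puts `1` (type `R`) or
`0` (type `E`) in front of that prefix. -/
theorem leftSpecial_self (h : IsEERR u A B C D) (n : ℕ) : LeftSpecial u u n := by
  intro a
  obtain ⟨N, hN, hp, hu⟩ := h.exists_long_pal (!a) n
  obtain ⟨q, -, hq⟩ := h.exists_mirror (!a) 0 (N + 1)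
  refine ⟨q, ?_, fun i hi => ?_⟩
  · have := hq 0 N (by omega)
    rw [Nat.zero_add, hu] at this
    rw [show q = q + 0 from rfl, this]
    simp
  · rw [Nat.add_assoc, hq (1 + i) (N - 1 - i) (by omega), Nat.zero_add,
      ← hp (N - 1 - i) i (by omega)]

theorem leftSpecial_compl (h : IsEERR u A B C D) {z : ℕ → Bool} {n : ℕ}
    (hz : LeftSpecial u z n) (c : Bool) : LeftSpecial u (fun i => xor (z i) c) n := by
  intro a
  obtain ⟨p, hp, hpz⟩ := hz (xor a c)
  obtain ⟨q, -, hq⟩ := h.exists_mirror false p (n + 1)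
  obtain ⟨r, -, hr⟩ := h.exists_mirror c q (n + 1)
  have key : ∀ x ≤ n, u (r + x) = xor (u (p + x)) c := by
    intro x hx
    rw [hr x (n - x) (by omega), hq (n - x) x (by omega)]
    simp
  refine ⟨r, ?_, fun i hi => ?_⟩
  · have := key 0 (Nat.zero_le _)
    rw [Nat.add_zero, Nat.add_zero, hp] at this
    rw [this]
    simp
  · rw [Nat.add_assoc, key (1 + i) (by omega), ← Nat.add_assoc, hpz i hi]

/-- A palindromic factor whose neighbours do not mirror each other is left special. -/
theorem leftSpecial_of_pal (h : IsEERR u A B C D) {c : Bool} {p m : ℕ}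
    (hpal : ∀ x y, x + y + 1 = m → u (p + 1 + x) = xor (u (p + 1 + y)) c)
    (hne : xor (u (p + 1 + m)) c = !u p) : LeftSpecial u (fun i => u (p + 1 + i)) m := by
  intro a
  by_cases ha : u p = a
  · exact ⟨p, ha, fun _ _ => rfl⟩
  · obtain ⟨q, -, hq⟩ := h.exists_mirror c (p + 1) (m + 1)
    refine ⟨q, ?_, fun i hi => ?_⟩
    · have := hq 0 m (by omega)
      rw [Nat.add_zero, hne] at this
      rw [this]
      revert ha
      cases u p <;> cases a <;> decide
    · rw [Nat.add_assoc, hq (1 + i) (m - 1 - i) (by omega), ← hpal i (m - 1 - i) (by omega)]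

/-- Reading from the last occurrence of `w` (length `A j`) in the palindrome of length `A (j + 1)`
gives `w 1 0` and then the complement of `u`. This contains the `R`-palindrome `w 1 0 v 0 1 w`, with
`v` the complement of the prefix of length `D j`, between the letters `1` and `0`. -/
theorem branches_B (h : IsEERR u A B C D) (j : ℕ) : Branches u (B j) (2 * A j + 4 + D j) := by
  obtain ⟨rB, rC, rD, rA⟩ := h.lengthRec j
  obtain ⟨rB', -, -, -⟩ := h.lengthRec (j + 1)
  have o := h.lt_of_lt (Nat.lt_add_one j)
  obtain ⟨p, hp⟩ : ∃ p, A (j + 1) = p + 1 + A j := ⟨A (j + 1) - A j - 1, by omega⟩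
  have hA := (h.stepB (j + 1)).pal
  have l1 : ∀ x < A j, u (p + 1 + x) = u x := by
    intro x hx
    rw [hA (A j - 1 - x) (p + 1 + x) (by omega), (h.stepB j).pal (A j - 1 - x) x (by omega)]
  have l2 : u (p + 1 + A j) = true := hp ▸ (h.stepB (j + 1)).letter
  have l3 : u (p + 1 + (A j + 1)) = false := by
    rw [← h.letter_A_succ rB', hp]
    rfl
  have l4 : ∀ i < A (j + 1), u (p + 1 + (A j + 2 + i)) = !u i := by
    intro i hi
    rw [← h.after_A rB' hi, hp]
    congr 1
    omega
  refine ⟨fun i => u (p + 1 + i), h.leftSpecial_of_pal (c := false) (fun x y hxy => ?_) ?_,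
    fun i hi => ?_, ?_⟩
  · have half : ∀ x y, x + y + 1 = 2 * A j + 4 + D j → x ≤ A j + 1 →
        u (p + 1 + y) = u (p + 1 + x) := by
      intro x y hxy hx
      rcases (show x = A j + 1 ∨ x = A j ∨ x < A j by omega) with rfl | rfl | hx
      · rw [l3, show y = A j + 2 + D j by omega, l4 _ (by omega), (h.stepA j).letter]
        rfl
      · rw [l2, show y = A j + 2 + (D j + 1) by omega, l4 _ (by omega),
          h.after_D rA (by omega), h.letter_A_succ rB]
        rfl
      · rw [l1 x hx, show y = A j + 2 + (D j + (2 + (A j - 1 - x))) by omega, l4 _ (by omega),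
          h.after_D rA (by omega), ← Nat.add_assoc, h.after_A rB (by omega),
          (h.stepB j).pal (A j - 1 - x) x (by omega)]
        simp
    rw [Bool.xor_false]
    rcases le_or_gt x (A j + 1) with hx | hx
    · exact (half x y hxy hx).symm
    rcases le_or_gt y (A j + 1) with hy | hy
    · exact half y x (by omega) hy
    · obtain ⟨x, rfl⟩ := Nat.exists_eq_add_of_le (show A j + 2 ≤ x from hx)
      obtain ⟨y, rfl⟩ := Nat.exists_eq_add_of_le (show A j + 2 ≤ y from hy)
      rw [l4 x (by omega), l4 y (by omega), (h.stepA j).pal x y (by omega), Bool.xor_false]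
  · rw [show 2 * A j + 4 + D j = A j + 2 + (D j + (A j + 2)) by omega, l4 _ (by omega),
      h.after_D rA (by omega), show A j + (A j + 2) = B j by omega, (h.stepC j).letter,
      hA (A j) p (by omega), (h.stepB j).letter]
    rfl
  · rcases (show i < A j ∨ i = A j ∨ i = A j + 1 ∨ A j + 2 ≤ i by omega) with hi | rfl | rfl | hi
    · exact l1 i hi
    · exact l2.trans (h.stepB j).letter.symm
    · exact l3.trans (h.letter_A_succ rB).symm
    · obtain ⟨i, rfl⟩ := Nat.exists_eq_add_of_le hi
      exact (l4 i (by omega)).trans (h.after_A rB (by omega)).symm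
  · change u (p + 1 + B j) ≠ u (B j)
    rw [(h.stepC j).letter, show B j = A j + 2 + A j by omega, l4 _ (by omega),
      (h.stepB j).letter]
    decide

/-- Reading from the final occurrence of the prefix of length `C j` in that of length `C (j + 1)`
gives `x`, of length `C j - 3`, followed by the complement of `u`. This contains the `E`-palindrome
`x v E(x)`, with `v` the complement of the prefix of length `B (j + 1)`, between two letters `0`. -/
theorem branches_D (h : IsEERR u A B C D) (j : ℕ) :
    Branches u (D j) (B (j + 1)) := by
  obtain ⟨rB, rC, rD, rA⟩ := h.lengthRec j
  obtain ⟨rB', rC', rD', -⟩ := h.lengthRec (j + 1)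
  simp only [prevLength] at rC'
  have o := h.lt_of_lt (Nat.lt_add_one j)
  have o' := h.lt_of_lt (Nat.lt_add_one (j + 1))
  have hprev := (h.palPrefix_prev j).2.2
  obtain ⟨p, hp⟩ : ∃ p, C (j + 1) = p + 1 + C j := ⟨C (j + 1) - C j - 1, by omega⟩
  have hC := (h.stepD (j + 1)).pal
  have l1 : ∀ x < C j, u (p + 1 + x) = u x := by
    intro x hx
    rw [hC (C j - 1 - x) (p + 1 + x) (by omega), (h.stepD j).pal (C j - 1 - x) x (by omega)]
  have hr := h.lengthRec 0
  have hz := h.zero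
  have rC0 := hr.recC
  have rB0 := hr.recB
  simp only [prevLength] at rC0
  obtain ⟨-, -, hp3⟩ := h.first_letters (by omega) (by omega)
  have l2 : ∀ i, 3 + i < C (j + 1) → u (p + 1 + (C j + i)) = !u (3 + i) := by
    intro i hi
    rw [← h.after_C rD' hi, hp]
    congr 1
    omega
  -- The prefix of length `C j` ends in `E(101) = 010`, so the complemented copy of `u` already
  -- starts three letters before its end.
  have hC3 : 3 < C j := by omega
  have l3 : ∀ i < C (j + 1), u (p + 1 + (C j - 3 + i)) = !u i := by
    intro i hi
    rcases lt_or_ge i 3 with h3 | h3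
    · rw [l1 _ (by omega), (h.stepD j).pal (2 - i) (C j - 3 + i) (by omega),
        hp3 i (2 - i) (by omega)]
      simp
    · obtain ⟨i, rfl⟩ := Nat.exists_eq_add_of_le h3
      rw [← l2 i hi]
      congr 1
      omega
  have spec : LeftSpecial u (fun i => u (p + 1 + i)) (2 * (C j - 3) + B (j + 1)) := by
    refine h.leftSpecial_of_pal (c := true) (fun x y hxy => ?_) ?_
    · have half : ∀ x y, x + y + 1 = 2 * (C j - 3) + B (j + 1) → x < C j - 3 →
          u (p + 1 + y) = !u (p + 1 + x) := by
        intro x y hxy hx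
        rw [l1 x (by omega), show y = C j - 3 + (B (j + 1) + (C j - 4 - x)) by omega,
          l3 _ (by omega), h.after_B (by simpa only [prevLength] using rC')
            (by simp only [prevLength]; omega)]
        simp only [prevLength]
        rw [h.after_C rD (by omega), (h.stepD j).pal x (3 + (C j - 4 - x)) (by omega)]
        simp
      rcases lt_or_ge x (C j - 3) with hx | hx
      · rw [half x y hxy hx]
        simp
      rcases lt_or_ge y (C j - 3) with hy | hy
      · rw [half y x (by omega) hy]
        simp
      · obtain ⟨x, rfl⟩ := Nat.exists_eq_add_of_le hx
        obtain ⟨y, rfl⟩ := Nat.exists_eq_add_of_le hy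
        rw [l3 x (by omega), l3 y (by omega), (h.stepC (j + 1)).pal x y (by omega)]
        simp
    · rw [show 2 * (C j - 3) + B (j + 1) = C j - 3 + (B (j + 1) + (C j - 3)) by omega,
        l3 _ (by omega), h.after_B (by simpa only [prevLength] using rC')
          (by simp only [prevLength]; omega)]
      simp only [prevLength]
      rw [show C j + (C j - 3) = D j by omega, (h.stepA j).letter, hC (C j) p (by omega),
        (h.stepD j).letter]
      rfl
  refine ⟨fun i => u (p + 1 + i), spec.mono (by omega), fun i hi => ?_, ?_⟩
  · rcases lt_or_ge i (C j) with hi' | hi'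
    · exact l1 i hi'
    · obtain ⟨i, rfl⟩ := Nat.exists_eq_add_of_le hi'
      exact (l2 i (by omega)).trans (h.after_C rD (by omega)).symm
  · change u (p + 1 + D j) ≠ u (D j)
    rw [(h.stepA j).letter, show D j = C j - 3 + C j by omega, l3 _ (by omega),
      (h.stepD j).letter]
    decide

/-! ### Counting -/

/-- Different branches leave `u` at different indices below `n`, and complements are told apart by
their first letter, which is where `0 < N` enters. -/
theorem complexity_succ_ge (h : IsEERR u A B C D) {n : ℕ} (hn : 0 < n) (T : Finset ℕ)
    (hT : ∀ N ∈ T, 0 < N ∧ N < n ∧ Branches u N n) :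
    complexity u n + 2 * (T.card + 1) ≤ complexity u (n + 1) := by
  choose! z hz hagree hdiff using fun N hN => (hT N hN).2.2
  let f : Option T → ℕ → Bool := fun o => o.elim u fun N => z N
  have hf : ∀ o, LeftSpecial u (f o) n := by
    rintro (_ | N)
    · exact h.leftSpecial_self n
    · exact hz N N.2
  have hf0 : ∀ o, f o 0 = true := by
    rintro (_ | N)
    · exact h.letter_zero
    · exact (hagree N N.2 0 (hT N N.2).1).trans h.letter_zero
  have hlt : ∀ N N' : T, N.1 < N'.1 → z N N ≠ z N' N := by
    intro N N' hlt he
    exact hdiff N N.2 (he.trans (hagree N' N'.2 N hlt))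
  have hfinj : ∀ o o', (∀ i < n, f o i = f o' i) → o = o' := by
    rintro (_ | N) (_ | N') hi
    · rfl
    · exact absurd (hi N' (hT N' N'.2).2.1).symm (hdiff N' N'.2)
    · exact absurd (hi N (hT N N.2).2.1) (hdiff N N.2)
    · rcases lt_trichotomy N.1 N'.1 with hl | hl | hl
      · exact absurd (hi N (hT N N.2).2.1) (hlt N N' hl)
      · exact congrArg some (Subtype.ext hl)
      · exact absurd (hi N' (hT N' N'.2).2.1).symm (hlt N' N hl)
  have key := complexity_add_card_le (ι := Option T × Bool) (u := u) (n := n)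
    (fun a i => xor (f a.1 i) a.2) (h.exists_left_extension n)
    (fun a => h.leftSpecial_compl (hf a.1) a.2) (by
      rintro ⟨o, c⟩ ⟨o', c'⟩ hi
      have hc : c = c' := by
        have := hi 0 hn
        simpa only [hf0, Bool.true_xor, Bool.not_inj_iff] using this
      subst hc
      have : o = o' := hfinj o o' fun i hi' => by simpa using hi i hi'
      rw [this])
  rw [Fintype.card_prod, Fintype.card_option, Fintype.card_coe, Fintype.card_bool] at key
  omega

theorem exists_branches (h : IsEERR u A B C D) {n : ℕ} (hn : 3 ≤ n) :
    ∃ N, 0 < N ∧ N < n ∧ Branches u N n := by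
  have hB0 := (h.lengthRec 0).recB
  have hz := h.zero
  -- The intervals `(B j, D j]` and `(D j, B (j + 1)]` tile all `n > B 0 = 2`.
  have key : ∀ j, B j < n → n ≤ B (j + 1) → ∃ N, 0 < N ∧ N < n ∧ Branches u N n := by
    intro j h1 h2
    have o := h.lt_of_lt (Nat.lt_add_one j)
    rcases le_or_gt n (D j) with hle | hgt
    · exact ⟨B j, by omega, h1, (h.branches_B j).mono (by omega)⟩
    · exact ⟨D j, by omega, hgt, (h.branches_D j).mono h2⟩
  have : ∀ j, n ≤ B (j + 1) → ∃ N, 0 < N ∧ N < n ∧ Branches u N n := by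
    intro j
    induction j with
    | zero => exact key 0 (by omega)
    | succ j ih =>
      intro hj
      rcases le_or_gt n (B (j + 1)) with hle | hgt
      · exact ih hle
      · exact key (j + 1) hgt hj
  refine this n ?_
  have := h.le_A (n + 1)
  have := (h.stepB (n + 1)).lt
  omega

theorem four_mul_lt_complexity (h : IsEERR u A B C D) {n : ℕ} (hn : 10 ≤ n) :
    4 * n < complexity u n := by
  induction n, hn using Nat.le_induction with
  | base =>
    obtain ⟨rB, rC, rD, rA⟩ := h.lengthRec 0
    have rB' := (h.lengthRec 1).recB
    have hz := h.zero
    simp only [prevLength] at rC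
    rw [Nat.zero_add] at rA
    have hb := h.branches_B 0
    have hd := h.branches_D 0
    rw [Nat.zero_add] at hd
    have c0 := complexity_add_card_le (ι := Unit) (fun _ => u) (h.exists_left_extension 0)
      (fun _ => h.leftSpecial_self 0) (fun _ _ _ => rfl)
    rw [complexity_zero, Fintype.card_unit, Nat.zero_add] at c0
    have s1 : ∀ n, 0 < n → complexity u n + 2 ≤ complexity u (n + 1) := fun n hn =>
      h.complexity_succ_ge hn ∅ (by simp)
    have s2 : ∀ n, 3 ≤ n → complexity u n + 4 ≤ complexity u (n + 1) := by
      intro n hn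
      obtain ⟨N, hN⟩ := h.exists_branches hn
      exact h.complexity_succ_ge (by omega) {N} (by simpa using hN)
    -- The range is that of lengths above `D 0 = 5` and at most `2 * A 0 + 4 + D 0 = 9`, where both
    -- branches exist.
    have s3 : ∀ n, 6 ≤ n → n ≤ 9 → complexity u n + 6 ≤ complexity u (n + 1) := by
      intro n hn hn'
      have := h.complexity_succ_ge (n := n) (by omega) {B 0, D 0} (by
        simp only [Finset.mem_insert, Finset.mem_singleton]
        rintro N (rfl | rfl)
        · exact ⟨by omega, by omega, hb.mono (by omega)⟩
        · exact ⟨by omega, by omega, hd.mono (by omega)⟩)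
      rwa [Finset.card_pair (by omega)] at this
    have : complexity u 1 + 2 ≤ complexity u 2 := s1 1 (by omega)
    have : complexity u 2 + 2 ≤ complexity u 3 := s1 2 (by omega)
    have : complexity u 3 + 4 ≤ complexity u 4 := s2 3 (by omega)
    have : complexity u 4 + 4 ≤ complexity u 5 := s2 4 (by omega)
    have : complexity u 5 + 4 ≤ complexity u 6 := s2 5 (by omega)
    have : complexity u 6 + 6 ≤ complexity u 7 := s3 6 (by omega) (by omega)
    have : complexity u 7 + 6 ≤ complexity u 8 := s3 7 (by omega) (by omega)
    have : complexity u 8 + 6 ≤ complexity u 9 := s3 8 (by omega) (by omega)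
    have : complexity u 9 + 6 ≤ complexity u 10 := s3 9 (by omega) (by omega)
    omega
  | succ n hn ih =>
    obtain ⟨N, hN⟩ := h.exists_branches (show 3 ≤ n by omega)
    have := h.complexity_succ_ge (n := n) (by omega) {N} (by simpa using hN)
    rw [Finset.card_singleton] at this
    omega

end IsEERR
end GenPseudostandard

open GenPseudostandard in
theorem four_mul_lt_complexity_word (n : ℕ) (hn : 10 ≤ n) :
    4 * n < complexity (word (omegaPower [true] (List.cons_ne_nil _ _))
      (omegaPower [.E, .E, .R, .R] (List.cons_ne_nil _ _))) n := by
  refine ((isPseudostandard_word _ _ fun n => ?_).isEERR (fun j => ?_) (fun j => ?_)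
    (fun j => ?_) (fun j => ?_)).four_mul_lt_complexity hn
  · simp [omegaPower]
  · simp [omegaPower, Antimorphism.exchanges]
  · simp [omegaPower, Antimorphism.exchanges, Nat.add_mod]
  · simp [omegaPower, Antimorphism.exchanges, Nat.add_mod]
  · simp [omegaPower, Antimorphism.exchanges, Nat.add_mod]

theorem mainTheorem1 :
    (∀ n : ℕ, 10 ≤ n →
      4 * n < GenPseudostandard.complexity
        (GenPseudostandard.word
          (GenPseudostandard.omegaPower [true] (List.cons_ne_nil _ _))
          (GenPseudostandard.omegaPower [.E, .E, .R, .R] (List.cons_ne_nil _ _))) n) ∧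
    ¬ (∀ (Δ : ℕ → Bool) (Θ : ℕ → GenPseudostandard.Antimorphism),
        ∃ n₀ : ℕ, ∀ n : ℕ, n₀ < n →
          GenPseudostandard.complexity (GenPseudostandard.word Δ Θ) n ≤ 4 * n) := by
  refine ⟨four_mul_lt_complexity_word, fun h => ?_⟩
  obtain ⟨n₀, hn₀⟩ := h (GenPseudostandard.omegaPower [true] (List.cons_ne_nil _ _))
    (GenPseudostandard.omegaPower [.E, .E, .R, .R] (List.cons_ne_nil _ _))
  have h1 := hn₀ (n₀ + 10) (by omega)
  have h2 := four_mul_lt_complexity_word (n₀ + 10) (by omega)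
  omega
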